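/- Let $\Theta\subseteq\mathbb R$ be an interval and consider a canonical one-parameter exponential family with parameter space $\Theta$: a measure $\nu$ on a measurable space $\mathcal X$, measurable functions $h\ge 0$ and $T$ on $\mathcal X$ and a function $A$ on $\Theta$ such that, for every $\theta\in\Theta$, $f(x\mid\theta)=h(x)\exp[\theta T(x)-A(\theta)]$ is a probability density with respect to $\nu$. For a sample $\mathbf x=(x_1,\dots,x_n)$ put $f(\mathbf x\mid\theta)=\prod_{i=1}^n f(x_i\mid\theta)$. Let $\theta_0$ be an interior point of $\Theta$ such that $A$ has three bounded derivatives in a neighborhood of $\theta_0$, let $\gamma>0$ with $\gamma\ne 1$, and let $\Theta_1\subseteq\Theta$ be the set of parameter values that the alternative allows (for instance $\Theta\cap(\theta_0,\infty)$ or $\Theta\cap(-\infty,\theta_0)$ for a one-sided test). For a probability measure $\pi$ concentrated on $\Theta_1$ (an alternative hypothesis), the Bayes factor against $H_0:\theta=\theta_0$ is $\mathrm{BF}_{\pi}(\mathbf x)=\int f(\mathbf x\mid\theta)\,\pi(d\theta)\,/\,f(\mathbf x\mid\theta_0)$. A value $\theta^*$ is said to define a $\mathrm{UMPBT}(\gamma)$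 for sample size $n$ if $\theta^*\in\Theta_1$ and $$P_{\theta_t}\bigl[\mathrm{BF}_{\delta_{\theta^*}}(\mathbf x)>\gamma\bigr]\ \ge\ P_{\theta_t}\bigl[\mathrm{BF}_{\pi_2}(\mathbf x)>\gamma\bigr]$$ for every $\theta_t\in\Theta$ and every probability measure $\pi_2$ concentrated on $\Theta_1$, where under $P_{\theta_t}$ the observations $x_1,\dots,x_n$ are i.i.d. with density $f(\cdot\mid\theta_t)$. Let $$g_\gamma(\theta,\theta_0)=\frac{\log\gamma+n[A(\theta)-A(\theta_0)]}{\theta-\theta_0}.$$ (1) Let $n\ge1$, and let $\theta^*$ be a value that defines a $\mathrm{UMPBT}(\gamma)$ for sample size $n$ and satisfies $\frac{d}{d\theta}g_\gamma(\theta^*,\theta_0)=0$ (the derivative being taken within $\Theta$). Then for some $t$ strictly between $\theta_0$ and $\theta^*$, $$|\theta^*-\theta_0|=\sqrt{\frac{2\log\gamma}{n\,A''(t)}}.$$ (2) Let $(\theta^*_n)$ be a sequence such that, for all sufficiently large $n$, $\theta^*_n$ defines a $\mathrm{UMPBT}(\gamma)$ for sample size $n$ and satisfies $\frac{d}{d\theta}g_\gamma(\theta^*_n,\theta_0)=0$.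 Let $X_1,X_2,\dots$ be i.i.d. with density $f(\cdot\mid\theta_0)$, and let $\mathrm{BF}_{10}$ denote the Bayes factor of $H_1:\theta=\theta_n^*$ against $H_0:\theta=\theta_0$ based on $X_1,\dots,X_n$. Then, as $n\to\infty$, $\log(\mathrm{BF}_{10})$ converges in distribution to the normal distribution with mean $-\log\gamma$ and variance $2\log\gamma$. -/

import Mathlib

open MeasureTheory ProbabilityTheory Filter Topology

noncomputable section

namespace UMPBT

variable {𝓧 : Type*} [MeasurableSpace 𝓧]

/-- The density `f(x | θ) = h(x) exp[θ T(x) - A(θ)]` of one observation, in canonical form. -/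
def density (h T : 𝓧 → ℝ) (A : ℝ → ℝ) (θ : ℝ) (x : 𝓧) : ℝ :=
  h x * Real.exp (θ * T x - A θ)

/-- The distribution of one observation with parameter `θ`: it has the density `f(· | θ)` with
respect to the underlying measure `ν`. -/
def law (ν : Measure 𝓧) (h T : 𝓧 → ℝ) (A : ℝ → ℝ) (θ : ℝ) : Measure 𝓧 :=
  ν.withDensity fun x => ENNReal.ofReal (density h T A θ x)

/-- `h`, `T`, `A` define a canonical one-parameter exponential family on the parameter space `Θ`,
an interval: for every `θ ∈ Θ` the function `f(· | θ)` is a probability density with respect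
to `ν`. Nothing is required of `A` outside `Θ`. -/
structure IsExpFamily (ν : Measure 𝓧) (h T : 𝓧 → ℝ) (A : ℝ → ℝ) (Θ : Set ℝ) : Prop where
  measurable_h : Measurable h
  measurable_T : Measurable T
  h_nonneg : ∀ x, 0 ≤ h x
  interval : Θ.OrdConnected
  lintegral_density : ∀ θ ∈ Θ, ∫⁻ x, ENNReal.ofReal (density h T A θ x) ∂ν = 1

/-- The density `f(x₁, …, xₙ | θ) = ∏ f(xᵢ | θ)` of a random sample of size `n`. -/
def sampleDensity (h T : 𝓧 → ℝ) (A : ℝ → ℝ) {n : ℕ} (θ : ℝ) (x : Fin n → 𝓧) : ℝ :=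
  ∏ i, density h T A θ (x i)

/-- The distribution of a random sample of size `n` with parameter `θ`. -/
def sampleLaw (ν : Measure 𝓧) (h T : 𝓧 → ℝ) (A : ℝ → ℝ) (n : ℕ) (θ : ℝ) :
    Measure (Fin n → 𝓧) :=
  Measure.pi fun _ => law ν h T A θ

/-- The marginal density `m(x) = ∫ f(x | θ) π(dθ)` of a sample under the prior `π`. -/
def marginal (h T : 𝓧 → ℝ) (A : ℝ → ℝ) {n : ℕ} (π : Measure ℝ) (x : Fin n → 𝓧) : ENNReal :=
  ∫⁻ θ, ENNReal.ofReal (sampleDensity h T A θ x) ∂π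

/-- The Bayes factor `BF₁₀(x) = m₁(x) / m₀(x)` between `H₁ : θ ∼ π₁` and the point null
hypothesis `H₀ : θ = θ₀`, whose prior is the point mass at `θ₀`. -/
def bayesFactor (h T : 𝓧 → ℝ) (A : ℝ → ℝ) (θ₀ : ℝ) {n : ℕ} (π₁ : Measure ℝ)
    (x : Fin n → 𝓧) : ENNReal :=
  marginal h T A π₁ x / marginal h T A (Measure.dirac θ₀) x

/-- An alternative hypothesis `H : θ ∼ π` that requires `θ` to belong to `Θ₁`. -/
def IsAlternative (Θ₁ : Set ℝ) (π : Measure ℝ) : Prop :=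
  IsProbabilityMeasure π ∧ ∀ᵐ θ ∂π, θ ∈ Θ₁

/-- The prior `π₁` defines a uniformly most powerful Bayesian test for evidence threshold `γ`,
based on a sample of size `n`, of `H₀ : θ = θ₀` against alternatives that require `θ ∈ Θ₁`:
whatever the data-generating parameter `θt ∈ Θ`, no alternative hypothesis `π₂` makes it more
probable that its Bayes factor against `H₀` exceeds `γ`. -/
def IsUMPBT (ν : Measure 𝓧) (h T : 𝓧 → ℝ) (A : ℝ → ℝ) (Θ Θ₁ : Set ℝ) (θ₀ γ : ℝ) (n : ℕ)
    (π₁ : Measure ℝ) : Prop :=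
  IsAlternative Θ₁ π₁ ∧
    ∀ θt ∈ Θ, ∀ π₂ : Measure ℝ, IsAlternative Θ₁ π₂ →
      sampleLaw ν h T A n θt {x | ENNReal.ofReal γ < bayesFactor h T A θ₀ π₂ x} ≤
        sampleLaw ν h T A n θt {x | ENNReal.ofReal γ < bayesFactor h T A θ₀ π₁ x}

/-- The objective function `g_γ(θ, θ₀)`, in canonical form and for samples of size `n`. -/
def g (A : ℝ → ℝ) (γ : ℝ) (n : ℕ) (θ₀ θ : ℝ) : ℝ :=
  (Real.log γ + n * (A θ - A θ₀)) / (θ - θ₀)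

/-- `θs` is a value of `θ` that defines a UMPBT(`γ`) (through the point mass at `θs`) and at which
the derivative of `g_γ(·, θ₀)`, as a function on the parameter space `Θ`, exists and is zero. -/
def IsStationaryUMPBT (ν : Measure 𝓧) (h T : 𝓧 → ℝ) (A : ℝ → ℝ) (Θ Θ₁ : Set ℝ) (θ₀ γ : ℝ)
    (n : ℕ) (θs : ℝ) : Prop :=
  IsUMPBT ν h T A Θ Θ₁ θ₀ γ n (Measure.dirac θs) ∧ HasDerivWithinAt (g A γ n θ₀) 0 Θ θs

/-- `A` has three bounded derivatives in a neighborhood of `θ₀`. -/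
def HasThreeBoundedDerivs (A : ℝ → ℝ) (θ₀ : ℝ) : Prop :=
  ∃ U ∈ 𝓝 θ₀, ∃ C : ℝ, ∀ θ ∈ U, ∀ k < 3,
    DifferentiableAt ℝ (iteratedDeriv k A) θ ∧ |iteratedDeriv (k + 1) A θ| ≤ C

/-- The weight of evidence `log BF₁₀(x)` for the alternative `H₁ : θ = θ₁`. -/
def weightOfEvidence (h T : 𝓧 → ℝ) (A : ℝ → ℝ) (θ₀ θ₁ : ℝ) {n : ℕ} (x : Fin n → 𝓧) : ℝ :=
  Real.log (bayesFactor h T A θ₀ (Measure.dirac θ₁) x).toReal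

end UMPBT

end

/-! Clearing the denominator in `g` shows that a zero of its derivative at `θs` says exactly that
the Bregman divergence `A θ₀ - A θs - A'(θs) (θ₀ - θs)` equals `log γ / n`. Taylor's formula centred
at `θs` turns this into `n (θs - θ₀)² A''(t) = 2 log γ`, which is (1). Since `θs` may be an endpoint
of `Θ`, Taylor's formula is proved from one-sided data, using convexity: up to translation `A` is
the cumulant generating function of `T`, so inside `Θ` it is analytic and `A''` is a variance.

For (2), the divergence grows as `θs` moves away from `θ₀` (`bregman_mono`), so `log γ / n → 0`
forces `θs n → θ₀` and then `n (θs n - θ₀)² → 2 log γ / A''(θ₀)`. The weight of evidence is `(θs n -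
θ₀) ∑ (T Xᵢ - A'(θ₀))` minus `n` times the second-order Taylor remainder of `A` at `θ₀`. The
remainder term tends to `log γ`; the sum is asymptotically normal with variance `2 log γ` by
`tendstoInDistribution_mul_sum_add`. -/

/-! ### Taylor's formula from one-sided data -/

/-- Second-order Taylor formula with Lagrange remainder for a convex function on `[0, 1]` that is
only known to have a one-sided derivative at `0`. -/
theorem ConvexOn.exists_taylor_two_unitInterval {φ φ' φ'' : ℝ → ℝ} {d : ℝ}
    (hφ : ConvexOn ℝ (Set.Icc 0 1) φ)
    (h1 : ∀ u ∈ Set.Ioo (0 : ℝ) 1, HasDerivAt φ (φ' u) u)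
    (h2 : ∀ u ∈ Set.Ioo (0 : ℝ) 1, HasDerivAt φ' (φ'' u) u)
    (h0 : HasDerivWithinAt φ d (Set.Icc 0 1) 0) (hc : ContinuousWithinAt φ (Set.Icc 0 1) 1) :
    ∃ t ∈ Set.Ioo (0 : ℝ) 1, φ 1 - φ 0 - d = φ'' t / 2 := by
  -- The derivative extends continuously to the endpoint: convexity squeezes `φ' u` between `d` and
  -- the slope over `[u, 2u]`, which is `2 * slope φ 0 (2 * u) - slope φ 0 u` and tends to `2d - d`.
  have hd : Tendsto φ' (𝓝[>] 0) (𝓝 d) := by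
    have hs : Tendsto (slope φ 0) (𝓝[>] 0) (𝓝 d) := by
      have := hasDerivWithinAt_iff_tendsto_slope.1 h0
      rw [Set.Icc_sdiff_left] at this
      rwa [nhdsWithin_Ioc_eq_nhdsGT zero_lt_one] at this
    have hmul : Tendsto (fun u : ℝ => 2 * u) (𝓝[>] 0) (𝓝[>] 0) := by
      refine tendsto_nhdsWithin_iff.2 ⟨?_, ?_⟩
      · have : Continuous fun u : ℝ => 2 * u := by fun_prop
        simpa using (this.tendsto 0).mono_left nhdsWithin_le_nhds
      · filter_upwards [self_mem_nhdsWithin] with u hu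
        simpa using hu
    have hupper : Tendsto (fun u => 2 * slope φ 0 (2 * u) - slope φ 0 u) (𝓝[>] 0) (𝓝 d) := by
      have := ((hs.comp hmul).const_mul 2).sub hs
      rwa [show 2 * d - d = d by ring] at this
    refine tendsto_of_tendsto_of_tendsto_of_le_of_le' tendsto_const_nhds hupper ?_ ?_
    · filter_upwards [Ioo_mem_nhdsGT (zero_lt_one (α := ℝ))] with u hu
      exact (hφ.le_slope_of_hasDerivWithinAt (by simp) ⟨hu.1.le, hu.2.le⟩ hu.1 h0).trans
        (hφ.slope_le_of_hasDerivAt (by simp) ⟨hu.1.le, hu.2.le⟩ hu.1 (h1 u hu))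
    · filter_upwards [Ioo_mem_nhdsGT (show (0 : ℝ) < 1 / 2 by norm_num)] with u hu
      have hu0 : 0 < u := hu.1
      have hu1 : u < 1 / 2 := hu.2
      refine (hφ.le_slope_of_hasDerivAt (y := 2 * u) ⟨by linarith, by linarith⟩
        ⟨by linarith, by linarith⟩ (by linarith) (h1 u ⟨hu0, by linarith⟩)).trans_eq ?_
      have := hu0.ne'
      rw [slope_def_field, slope_def_field, slope_def_field, show 2 * u - u = u by ring, sub_zero,
        sub_zero]
      field_simp
      ring
  have hright : Tendsto φ (𝓝[<] 1) (𝓝 (φ 1)) := by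
    have := hc.mono Set.Ico_subset_Icc_self
    rwa [ContinuousWithinAt, nhdsWithin_Ico_eq_nhdsLT zero_lt_one] at this
  have hleft : Tendsto φ (𝓝[>] 0) (𝓝 (φ 0)) := by
    have := h0.continuousWithinAt.mono Set.Ioc_subset_Icc_self
    rwa [ContinuousWithinAt, nhdsWithin_Ioc_eq_nhdsGT zero_lt_one] at this
  -- Cauchy's mean value theorem against `u ^ 2` gives `φ 1 - φ 0 - d = (φ' c - d) / (2c)`; a second
  -- application, to `φ'` on `(0, c)`, gives `φ' c - d = c φ'' t`. Only one-sided limits at the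
  -- endpoints are needed.
  obtain ⟨c, hc, hceq⟩ := exists_ratio_hasDerivAt_eq_ratio_slope' (fun u => φ u - d * u)
    (fun u => φ' u - d) zero_lt_one (fun u => u ^ 2) (fun u => 2 * u)
    (lfa := φ 0 - d * 0) (lga := 0 ^ 2) (lfb := φ 1 - d * 1) (lgb := 1 ^ 2)
    (fun u hu => (h1 u hu).fun_sub (by simpa using (hasDerivAt_id u).const_mul d))
    (fun u _ => by simpa using hasDerivAt_pow 2 u)
    (hleft.sub (tendsto_const_nhds.mul (tendsto_id.mono_left nhdsWithin_le_nhds)))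
    ((tendsto_id.mono_left nhdsWithin_le_nhds).pow 2)
    (hright.sub (tendsto_const_nhds.mul (tendsto_id.mono_left nhdsWithin_le_nhds)))
    ((tendsto_id.mono_left nhdsWithin_le_nhds).pow 2)
  obtain ⟨t, ht, hteq⟩ := exists_ratio_hasDerivAt_eq_ratio_slope' φ' φ'' hc.1 id (fun _ => 1)
    (lfa := d) (lga := 0) (lfb := φ' c) (lgb := c)
    (fun u hu => h2 u ⟨hu.1, hu.2.trans hc.2⟩) (fun u _ => hasDerivAt_id u) hd
    (tendsto_id.mono_left nhdsWithin_le_nhds)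
    ((h2 c hc).continuousAt.tendsto.mono_left nhdsWithin_le_nhds)
    (tendsto_id.mono_left nhdsWithin_le_nhds)
  refine ⟨t, ⟨ht.1, ht.2.trans hc.2⟩, ?_⟩
  have hc0 : c ≠ 0 := hc.1.ne'
  have : c * (2 * (φ 1 - φ 0 - d) - φ'' t) = 0 := by linear_combination -hceq - hteq
  rcases mul_eq_zero.1 this with h | h
  · exact absurd h hc0
  · linarith

/-- Second-order Taylor formula with Lagrange remainder, between two points in either order, for a
function with nonnegative second derivative in between that is only known to have a one-sided
derivative at the centre of the expansion and to be continuous at the other point. -/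
theorem exists_taylor_two_of_nonneg {f f' f'' : ℝ → ℝ} {x y d : ℝ} (hxy : x ≠ y)
    (h1 : ∀ u ∈ Set.Ioo (min x y) (max x y), HasDerivAt f (f' u) u)
    (h2 : ∀ u ∈ Set.Ioo (min x y) (max x y), HasDerivAt f' (f'' u) u)
    (hnn : ∀ u ∈ Set.Ioo (min x y) (max x y), 0 ≤ f'' u)
    (hx : HasDerivWithinAt f d (Set.uIcc x y) x)
    (hy : ContinuousWithinAt f (Set.uIcc x y) y) :
    ∃ t ∈ Set.Ioo (min x y) (max x y), f y - f x - d * (y - x) = (y - x) ^ 2 / 2 * f'' t := by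
  set l : ℝ → ℝ := fun u => x + u * (y - x) with hl
  have hl' : ∀ u, HasDerivAt l (y - x) u := fun u =>
    (HasDerivAt.const_add x (by simpa using (hasDerivAt_id u).mul_const (y - x)))
  have hmapO : ∀ u ∈ Set.Ioo (0 : ℝ) 1, l u ∈ Set.Ioo (min x y) (max x y) := by
    rintro u ⟨hu0, hu1⟩
    rcases lt_or_gt_of_ne hxy with h | h
    · rw [min_eq_left h.le, max_eq_right h.le]
      constructor <;> simp only [hl] <;> nlinarith
    · rw [min_eq_right h.le, max_eq_left h.le]
      constructor <;> simp only [hl] <;> nlinarith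
  have hmapC : Set.MapsTo l (Set.Icc 0 1) (Set.uIcc x y) := by
    rintro u ⟨hu0, hu1⟩
    rw [Set.mem_uIcc]
    rcases lt_or_gt_of_ne hxy with h | h
    · left
      constructor <;> simp only [hl] <;> nlinarith
    · right
      constructor <;> simp only [hl] <;> nlinarith
  have l0 : l 0 = x := by simp [hl]
  have l1 : l 1 = y := by simp [hl]
  have d1 : ∀ u ∈ Set.Ioo (0 : ℝ) 1, HasDerivAt (f ∘ l) (f' (l u) * (y - x)) u := fun u hu =>
    (h1 _ (hmapO u hu)).comp u (hl' u)
  have d2 : ∀ u ∈ Set.Ioo (0 : ℝ) 1,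
      HasDerivAt (fun u => f' (l u) * (y - x)) (f'' (l u) * (y - x) * (y - x)) u := fun u hu =>
    ((h2 _ (hmapO u hu)).comp u (hl' u)).mul_const (y - x)
  have d0 : HasDerivWithinAt (f ∘ l) (d * (y - x)) (Set.Icc 0 1) 0 :=
    HasDerivWithinAt.comp 0 (by rwa [l0]) (hl' 0).hasDerivWithinAt hmapC
  have c1 : ContinuousWithinAt (f ∘ l) (Set.Icc 0 1) 1 :=
    ContinuousWithinAt.comp (by rwa [l1]) (hl' 1).continuousAt.continuousWithinAt hmapC
  have hcont : ContinuousOn (f ∘ l) (Set.Icc 0 1) := by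
    rintro u ⟨hu0, hu1⟩
    rcases hu0.eq_or_lt with rfl | hu0
    · exact d0.continuousWithinAt
    rcases hu1.eq_or_lt with rfl | hu1
    · exact c1
    exact (d1 u ⟨hu0, hu1⟩).continuousAt.continuousWithinAt
  have hconv : ConvexOn ℝ (Set.Icc 0 1) (f ∘ l) := by
    have hev : ∀ u ∈ Set.Ioo (0 : ℝ) 1, deriv (f ∘ l) =ᶠ[𝓝 u] fun u => f' (l u) * (y - x) := by
      intro u hu
      filter_upwards [isOpen_Ioo.mem_nhds hu] with v hv using (d1 v hv).deriv
    refine convexOn_of_deriv2_nonneg (convex_Icc 0 1) hcont ?_ ?_ ?_ <;> rw [interior_Icc]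
    · exact fun u hu => (d1 u hu).differentiableAt.differentiableWithinAt
    · exact fun u hu =>
        ((d2 u hu).congr_of_eventuallyEq (hev u hu)).differentiableAt.differentiableWithinAt
    · intro u hu
      rw [Function.iterate_succ_apply, Function.iterate_one,
        ((d2 u hu).congr_of_eventuallyEq (hev u hu)).deriv, mul_assoc]
      exact mul_nonneg (hnn _ (hmapO u hu)) (mul_self_nonneg _)
  obtain ⟨t, ht, h⟩ := hconv.exists_taylor_two_unitInterval d1 d2 d0 c1
  refine ⟨l t, hmapO t ht, ?_⟩
  simp only [Function.comp, l0, l1] at h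
  rw [h]
  ring

/-! ### The exponential family: `A` as a cumulant generating function -/

namespace UMPBT

variable {𝓧 : Type*} [MeasurableSpace 𝓧] {ν : Measure 𝓧} {h T : 𝓧 → ℝ} {A : ℝ → ℝ} {Θ : Set ℝ}

theorem IsExpFamily.measurable_density (hfam : IsExpFamily ν h T A Θ) (θ : ℝ) :
    Measurable (density h T A θ) := by
  have := hfam.measurable_h
  have := hfam.measurable_T
  unfold density
  fun_prop

theorem IsExpFamily.density_nonneg (hfam : IsExpFamily ν h T A Θ) (θ : ℝ) (x : 𝓧) :
    0 ≤ density h T A θ x :=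
  mul_nonneg (hfam.h_nonneg x) (Real.exp_pos _).le

theorem IsExpFamily.isProbabilityMeasure_law (hfam : IsExpFamily ν h T A Θ) {θ : ℝ}
    (hθ : θ ∈ Θ) : IsProbabilityMeasure (law ν h T A θ) :=
  ⟨by simpa [law] using hfam.lintegral_density θ hθ⟩

theorem IsExpFamily.ae_law_pos (hfam : IsExpFamily ν h T A Θ) (θ : ℝ) :
    ∀ᵐ x ∂law ν h T A θ, 0 < h x := by
  rw [law, ae_withDensity_iff (hfam.measurable_density θ).ennreal_ofReal]
  refine Eventually.of_forall fun x hx => (hfam.h_nonneg x).lt_of_ne fun h0 => hx ?_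
  simp [density, ← h0]

/-- Exponential tilting: `exp ((s - θ) T)` times the density at `θ` is `exp (A s - A θ)` times the
density at `s`, which integrates to one. -/
theorem IsExpFamily.lintegral_exp_law (hfam : IsExpFamily ν h T A Θ) (θ : ℝ) {s : ℝ}
    (hs : s ∈ Θ) :
    ∫⁻ x, ENNReal.ofReal (Real.exp ((s - θ) * T x)) ∂law ν h T A θ =
      ENNReal.ofReal (Real.exp (A s - A θ)) := by
  have hT := hfam.measurable_T
  rw [law, lintegral_withDensity_eq_lintegral_mul _ (hfam.measurable_density θ).ennreal_ofReal
    (by fun_prop)]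
  calc _ = ∫⁻ x, ENNReal.ofReal (Real.exp (A s - A θ)) *
        ENNReal.ofReal (density h T A s x) ∂ν := by
        refine lintegral_congr fun x => ?_
        rw [Pi.mul_apply, ← ENNReal.ofReal_mul (hfam.density_nonneg θ x),
          ← ENNReal.ofReal_mul (Real.exp_pos _).le]
        congr 1
        rw [density, density, mul_assoc, ← Real.exp_add, mul_left_comm, ← Real.exp_add]
        ring_nf
    _ = _ := by
        rw [lintegral_const_mul _ (hfam.measurable_density s).ennreal_ofReal,
          hfam.lintegral_density s hs, mul_one]

theorem IsExpFamily.integrable_exp_law (hfam : IsExpFamily ν h T A Θ) (θ : ℝ) {s : ℝ}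
    (hs : s ∈ Θ) : Integrable (fun x => Real.exp ((s - θ) * T x)) (law ν h T A θ) := by
  have hT := hfam.measurable_T
  refine ⟨by fun_prop, ?_⟩
  rw [hasFiniteIntegral_iff_ofReal (Eventually.of_forall fun x => (Real.exp_pos _).le),
    hfam.lintegral_exp_law θ hs]
  exact ENNReal.ofReal_lt_top

theorem IsExpFamily.cgf_law (hfam : IsExpFamily ν h T A Θ) (θ : ℝ) {s : ℝ} (hs : s ∈ Θ) :
    cgf T (law ν h T A θ) (s - θ) = A s - A θ := by
  have hT := hfam.measurable_T
  rw [cgf, mgf, integral_eq_lintegral_of_nonneg_ae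
    (Eventually.of_forall fun x => (Real.exp_pos _).le) (by fun_prop),
    hfam.lintegral_exp_law θ hs, ENNReal.toReal_ofReal (Real.exp_pos _).le, Real.log_exp]

theorem IsExpFamily.eventuallyEq_cgf (hfam : IsExpFamily ν h T A Θ) {θ : ℝ} (hθ : Θ ∈ 𝓝 θ) :
    A =ᶠ[𝓝 θ] fun s => A θ + cgf T (law ν h T A θ) (s - θ) := by
  filter_upwards [hθ] with s hs
  rw [hfam.cgf_law θ hs]
  ring

theorem IsExpFamily.zero_mem_interior_integrableExpSet (hfam : IsExpFamily ν h T A Θ) {θ : ℝ}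
    (hθ : Θ ∈ 𝓝 θ) : 0 ∈ interior (integrableExpSet T (law ν h T A θ)) := by
  rw [mem_interior_iff_mem_nhds]
  have : Tendsto (fun u => u + θ) (𝓝 0) (𝓝 θ) := by
    simpa using (continuous_add_const θ).tendsto 0
  filter_upwards [this hθ] with u hu
  simpa [integrableExpSet] using hfam.integrable_exp_law θ hu

theorem IsExpFamily.analyticAt (hfam : IsExpFamily ν h T A Θ) {θ : ℝ} (hθ : Θ ∈ 𝓝 θ) :
    AnalyticAt ℝ A θ := by
  refine AnalyticAt.congr ?_ (hfam.eventuallyEq_cgf hθ).symm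
  refine analyticAt_const.add (AnalyticAt.comp_of_eq (g := cgf T (law ν h T A θ)) (y := 0)
    (analyticAt_cgf (hfam.zero_mem_interior_integrableExpSet hθ)) ?_ (by simp))
  exact analyticAt_id.sub analyticAt_const

theorem IsExpFamily.deriv_eq_integral (hfam : IsExpFamily ν h T A Θ) {θ : ℝ} (hθ : Θ ∈ 𝓝 θ) :
    deriv A θ = ∫ x, T x ∂law ν h T A θ := by
  have := hfam.isProbabilityMeasure_law (mem_of_mem_nhds hθ)
  rw [(hfam.eventuallyEq_cgf hθ).deriv_eq, deriv_const_add, deriv_comp_sub_const, sub_self,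
    deriv_cgf_zero (hfam.zero_mem_interior_integrableExpSet hθ)]
  simp

theorem IsExpFamily.iteratedDeriv_two_eq_variance (hfam : IsExpFamily ν h T A Θ) {θ : ℝ}
    (hθ : Θ ∈ 𝓝 θ) : iteratedDeriv 2 A θ = Var[T; law ν h T A θ] := by
  have := hfam.isProbabilityMeasure_law (mem_of_mem_nhds hθ)
  have h0 := hfam.zero_mem_interior_integrableExpSet hθ
  have hT := hfam.measurable_T
  have e : iteratedDeriv 2 A θ = iteratedDeriv 2 (cgf T (law ν h T A θ)) 0 := by
    rw [iteratedDeriv_succ, iteratedDeriv_one, iteratedDeriv_succ, iteratedDeriv_one,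
      (hfam.eventuallyEq_cgf hθ).deriv.deriv_eq]
    simp only [deriv_const_add']
    rw [show deriv (fun s => cgf T (law ν h T A θ) (s - θ)) =
      fun s => deriv (cgf T (law ν h T A θ)) (s - θ) from funext fun s => deriv_comp_sub_const ..,
      deriv_comp_sub_const, sub_self]
  rw [e, iteratedDeriv_two_cgf_eq_integral h0, deriv_cgf_zero h0, variance_eq_integral (by fun_prop)]
  simp

theorem IsExpFamily.iteratedDeriv_two_nonneg (hfam : IsExpFamily ν h T A Θ) {θ : ℝ}
    (hθ : Θ ∈ 𝓝 θ) : 0 ≤ iteratedDeriv 2 A θ :=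
  hfam.iteratedDeriv_two_eq_variance hθ ▸ variance_nonneg _ _

theorem IsExpFamily.memLp_two (hfam : IsExpFamily ν h T A Θ) {θ : ℝ} (hθ : Θ ∈ 𝓝 θ) :
    MemLp T 2 (law ν h T A θ) := by
  simpa using memLp_of_mem_interior_integrableExpSet
    (hfam.zero_mem_interior_integrableExpSet hθ) 2

/-- If `T` is degenerate at an interior parameter then `A` is affine. -/
theorem IsExpFamily.eq_affine_of_iteratedDeriv_two_eq_zero (hfam : IsExpFamily ν h T A Θ) {θ : ℝ}
    (hθ : Θ ∈ 𝓝 θ) (h0 : iteratedDeriv 2 A θ = 0) {s : ℝ} (hs : s ∈ Θ) :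
    A s = A θ + deriv A θ * (s - θ) := by
  have := hfam.isProbabilityMeasure_law (mem_of_mem_nhds hθ)
  rw [hfam.iteratedDeriv_two_eq_variance hθ] at h0
  -- Zero variance makes `T` almost surely constant, and a constant has a linear cumulant generating
  -- function.
  have hc := ae_eq_integral_of_variance_eq_zero (hfam.memLp_two hθ) h0
  have := hfam.cgf_law θ hs
  rw [cgf, mgf_congr hc, mgf_const, Real.log_exp, ← hfam.deriv_eq_integral hθ] at this
  linarith

/-- An interval contains a neighborhood of every point strictly between two of its points. -/
theorem _root_.Set.OrdConnected.mem_nhds_of_mem_Ioo {s : Set ℝ} (hs : s.OrdConnected) {x y t : ℝ}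
    (hx : x ∈ s) (hy : y ∈ s) (ht : t ∈ Set.Ioo (min x y) (max x y)) : s ∈ 𝓝 t :=
  mem_of_superset (isOpen_Ioo.mem_nhds ht) (Set.Ioo_subset_Icc_self.trans (hs.uIcc_subset hx hy))

/-- Either point may be an endpoint of `Θ`; points strictly between them are interior, where `A` is
analytic and `A''` is a variance. -/
theorem IsExpFamily.exists_taylor_two (hfam : IsExpFamily ν h T A Θ) {x y d : ℝ} (hxy : x ≠ y)
    (hx : x ∈ Θ) (hy : y ∈ Θ) (hdx : HasDerivWithinAt A d Θ x) (hcy : ContinuousWithinAt A Θ y) :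
    ∃ t ∈ Set.Ioo (min x y) (max x y),
      A y - A x - d * (y - x) = (y - x) ^ 2 / 2 * iteratedDeriv 2 A t := by
  have hn := fun t ht => hfam.interval.mem_nhds_of_mem_Ioo (t := t) hx hy ht
  have hsub := hfam.interval.uIcc_subset hx hy
  refine exists_taylor_two_of_nonneg (f' := deriv A) hxy
    (fun u hu => (hfam.analyticAt (hn u hu)).differentiableAt.hasDerivAt) (fun u hu => ?_)
    (fun u hu => hfam.iteratedDeriv_two_nonneg (hn u hu)) (hdx.mono hsub) (hcy.mono hsub)
  rw [iteratedDeriv_succ, iteratedDeriv_one]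
  exact (hfam.analyticAt (hn u hu)).deriv.differentiableAt.hasDerivAt

end UMPBT

/-! ### A central limit theorem with general norming -/

/-- The characteristic function of a centered square-integrable random variable, up to second
order. -/
theorem isLittleO_charFun_map_sub {Ω : Type*} [MeasurableSpace Ω] {P : Measure Ω}
    [IsProbabilityMeasure P] {Y : Ω → ℝ} (hY : MemLp Y 2 P) (h0 : P[Y] = 0) :
    (fun t : ℝ => charFun (P.map Y) t - (1 - (Var[Y; P] : ℂ) * t ^ 2 / 2)) =o[𝓝 0]
      fun t : ℝ => t ^ 2 := by
  have hm := hY.1.aemeasurable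
  have hid : MemLp id 2 (P.map Y) := (memLp_map_measure_iff (by fun_prop) hm).2 hY
  have : IsProbabilityMeasure (P.map Y) := Measure.isProbabilityMeasure_map hm
  have hsq : P[Y ^ 2] = Var[Y; P] := (variance_of_integral_eq_zero hm h0).symm
  have e := fun t : ℝ => taylorWithinEval_charFun_two_zero hm hid t
  simp only [h0, hsq, Complex.ofReal_zero, zero_mul, add_zero] at e
  simp_rw [← e]
  convert! taylor_isLittleO_univ ?_
  · simp
  · exact contDiff_charFun hid

/-- A central limit theorem for sums of centered i.i.d. random variables with general norming and
centering constants. The signs of the norming constants need not stabilize. -/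
theorem tendstoInDistribution_mul_sum_add {Ω : Type*} [MeasurableSpace Ω] {P : Measure Ω}
    [IsProbabilityMeasure P] {Y : ℕ → Ω → ℝ} (hindep : iIndepFun Y P)
    (hident : ∀ i, IdentDistrib (Y i) (Y 0) P P) (hY : MemLp (Y 0) 2 P) (h0 : P[Y 0] = 0)
    {a b : ℕ → ℝ} {τ β : ℝ} (ha : Tendsto (fun n : ℕ => n * a n ^ 2) atTop (𝓝 τ))
    (hb : Tendsto b atTop (𝓝 β)) :
    TendstoInDistribution (fun (n : ℕ) ω => a n * ∑ i ∈ Finset.range n, Y i ω + b n) atTop id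
      (fun _ => P) (gaussianReal β (τ * Var[Y 0; P]).toNNReal) := by
  have hm := fun i => (hident i).aemeasurable_fst
  have hms : ∀ n : ℕ, AEMeasurable (fun ω => ∑ i ∈ Finset.range n, Y i ω) P := fun n =>
    Finset.aemeasurable_fun_sum _ fun _ _ => hm _
  refine ⟨fun n => ((hms n).const_mul _).add_const _, aemeasurable_id, ?_⟩
  refine ProbabilityMeasure.tendsto_iff_tendsto_charFun.2 fun u => ?_
  have hτ : 0 ≤ τ := ge_of_tendsto' ha fun n => by positivity
  have hcf : ∀ n : ℕ, charFun (P.map fun ω => a n * ∑ i ∈ Finset.range n, Y i ω + b n) u =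
      charFun (P.map (Y 0)) (a n * u) ^ n * Complex.exp (b n * u * Complex.I) := by
    intro n
    have : (P.map fun ω => a n * ∑ i ∈ Finset.range n, Y i ω + b n) =
        (P.map fun ω => a n * ∑ i ∈ Finset.range n, Y i ω).map (· + b n) := by
      rw [AEMeasurable.map_map_of_aemeasurable (by fun_prop) ((hms n).const_mul _)]
      rfl
    rw [this, charFun_map_add_const, charFun_map_mul_comp (hms n),
      (hindep.restrict _).charFun_map_fun_finsetSum_eq_prod (fun _ _ => hm _)]
    congr 1
    · simp [fun i => (hident i).map_eq]
    · simp [mul_comm]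
  have ha0 : Tendsto (fun n => a n * u) atTop (𝓝 0) := by
    have h1 : Tendsto (fun n => a n ^ 2) atTop (𝓝 0) := by
      have := ha.mul (tendsto_inv_atTop_nhds_zero_nat (𝕜 := ℝ))
      rw [mul_zero] at this
      refine this.congr' ?_
      filter_upwards [eventually_ne_atTop 0] with n hn
      field_simp
    have h2 : Tendsto a atTop (𝓝 0) := by
      rw [tendsto_zero_iff_abs_tendsto_zero]
      have := (Real.continuous_sqrt.tendsto 0).comp h1
      simpa [Function.comp_def, Real.sqrt_sq_eq_abs] using this
    simpa using h2.mul_const u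
  have hsmall := (isLittleO_charFun_map_sub hY h0).comp_tendsto ha0
  -- Only `a n ^ 2` enters the second-order expansion, so the sign of `a n` is irrelevant. The limit
  -- then follows from `(1 + zₙ / n) ^ n → exp z` with `zₙ` the sequence below.
  have hlin : Tendsto (fun n : ℕ => (n : ℂ) * (charFun (P.map (Y 0)) (a n * u) - 1)) atTop
      (𝓝 (-(τ * Var[Y 0; P] * u ^ 2 / 2 : ℝ))) := by
    have h1 : Tendsto (fun n : ℕ => (n : ℂ) * (charFun (P.map (Y 0)) (a n * u) -
        (1 - (Var[Y 0; P] : ℂ) * ((a n * u : ℝ) : ℂ) ^ 2 / 2))) atTop (𝓝 0) := by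
      have h2 : (fun n : ℕ => (n : ℂ) * (charFun (P.map (Y 0)) (a n * u) -
        (1 - (Var[Y 0; P] : ℂ) * ((a n * u : ℝ) : ℂ) ^ 2 / 2))) =o[atTop]
          fun n : ℕ => (n : ℝ) * (a n * u) ^ 2 :=
        Asymptotics.IsBigO.mul_isLittleO
          (Asymptotics.isBigO_of_le _ fun n => by simp) hsmall
      have h3 : (fun n : ℕ => (n : ℝ) * (a n * u) ^ 2) =O[atTop] fun _ => (1 : ℝ) := by
        refine Tendsto.isBigO_one ℝ (c := τ * u ^ 2) ?_
        refine (ha.mul_const (u ^ 2)).congr fun n => ?_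
        ring
      exact (Asymptotics.isLittleO_one_iff ℝ).1 (h2.trans_isBigO h3)
    have h4 : Tendsto (fun n : ℕ => ((n * a n ^ 2 * (Var[Y 0; P] * u ^ 2 / 2) : ℝ) : ℂ)) atTop
        (𝓝 ((τ * (Var[Y 0; P] * u ^ 2 / 2) : ℝ) : ℂ)) :=
      (Complex.continuous_ofReal.tendsto _).comp (ha.mul_const _)
    convert h1.sub h4 using 2
    · push_cast
      ring
    · push_cast
      ring
  have hpow := Complex.tendsto_one_add_pow_exp_of_tendsto hlin
  simp only [add_sub_cancel] at hpow
  have hexp : Tendsto (fun n => Complex.exp (b n * u * Complex.I)) atTop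
      (𝓝 (Complex.exp (β * u * Complex.I))) := by
    refine (Complex.continuous_exp.tendsto _).comp ?_
    exact (((Complex.continuous_ofReal.tendsto _).comp hb).mul_const _).mul_const _
  simp only [ProbabilityMeasure.coe_mk, hcf, Measure.map_id]
  rw [charFun_gaussianReal, Real.coe_toNNReal _ (mul_nonneg hτ (variance_nonneg _ _))]
  convert hpow.mul hexp using 2
  rw [← Complex.exp_add]
  congr 1
  push_cast
  ring


/-! ### Weight of evidence, stationarity and Bregman divergence -/

namespace UMPBT

theorem marginal_dirac {𝓧 : Type*} (h T : 𝓧 → ℝ) (A : ℝ → ℝ) {n : ℕ} (θ : ℝ) (x : Fin n → 𝓧) :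
    marginal h T A (Measure.dirac θ) x = ENNReal.ofReal (sampleDensity h T A θ x) := by
  rw [marginal, lintegral_dirac]

theorem weightOfEvidence_eq {𝓧 : Type*} {h : 𝓧 → ℝ} (T : 𝓧 → ℝ) (A : ℝ → ℝ) (θ₀ θ₁ : ℝ) {n : ℕ} {x : Fin n → 𝓧}
    (hx : ∀ i, 0 < h (x i)) :
    weightOfEvidence h T A θ₀ θ₁ x = (θ₁ - θ₀) * ∑ i, T (x i) - n * (A θ₁ - A θ₀) := by
  have hd : ∀ θ i, 0 < density h T A θ (x i) := fun θ i => mul_pos (hx i) (Real.exp_pos _)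
  have hs : ∀ θ, 0 < sampleDensity h T A θ x := fun θ => Finset.prod_pos fun i _ => hd θ i
  have hl : ∀ θ, Real.log (sampleDensity h T A θ x) =
      ∑ i, Real.log (h (x i)) + θ * ∑ i, T (x i) - n * A θ := by
    intro θ
    rw [sampleDensity, Real.log_prod fun i _ => (hd θ i).ne', Finset.mul_sum,
      ← Finset.sum_add_distrib]
    simp only [density, Real.log_mul (hx _).ne' (Real.exp_pos _).ne', Real.log_exp]
    simp only [← add_sub_assoc, Finset.sum_sub_distrib]
    simp
  rw [weightOfEvidence, bayesFactor, marginal_dirac, marginal_dirac, ENNReal.toReal_div,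
    ENNReal.toReal_ofReal (hs _).le, ENNReal.toReal_ofReal (hs _).le,
    Real.log_div (hs _).ne' (hs _).ne', hl, hl]
  ring

variable {𝓧 : Type*} [MeasurableSpace 𝓧] {ν : Measure 𝓧} {h T : 𝓧 → ℝ} {A : ℝ → ℝ}
  {Θ Θ₁ : Set ℝ} {θ₀ γ : ℝ}

theorem IsStationaryUMPBT.mem {n : ℕ} {θs : ℝ}
    (hs : IsStationaryUMPBT ν h T A Θ Θ₁ θ₀ γ n θs) : θs ∈ Θ₁ := by
  simpa [ae_dirac_eq] using hs.1.1.2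

/-- The objective function blows up at `θ₀`, so it is not differentiable there. -/
theorem ne_of_hasDerivWithinAt_g (hΘ : Θ ∈ 𝓝 θ₀) (hA : ContinuousAt A θ₀) (hγ : 0 < γ)
    (hγ_ne : γ ≠ 1) {n : ℕ} {θs d : ℝ} (hg : HasDerivWithinAt (g A γ n θ₀) d Θ θs) :
    θs ≠ θ₀ := by
  rintro rfl
  have hc := (hg.hasDerivAt hΘ).continuousAt.tendsto
  have hid : Tendsto (fun θ => θ - θs) (𝓝 θs) (𝓝 0) := by
    simpa using (continuous_sub_right θs).tendsto θs
  -- Division by zero gives `g` a value at `θ₀`, so the contradiction is found in the punctured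
  -- neighborhood: the numerator would tend both to `0` and to `log γ`.
  have h1 : Tendsto (fun θ => g A γ n θs θ * (θ - θs)) (𝓝[≠] θs) (𝓝 0) := by
    simpa using (hc.mul hid).mono_left nhdsWithin_le_nhds
  have h2 : Tendsto (fun θ => Real.log γ + n * (A θ - A θs)) (𝓝[≠] θs) (𝓝 (Real.log γ)) := by
    have := ((hA.tendsto.sub_const (A θs)).const_mul (n : ℝ)).const_add (Real.log γ)
    simpa using this.mono_left nhdsWithin_le_nhds
  have h3 := tendsto_nhds_unique h2 (h1.congr' (by
    filter_upwards [self_mem_nhdsWithin] with θ hθ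
    exact div_mul_cancel₀ _ (sub_ne_zero.2 hθ)))
  exact Real.log_ne_zero_of_pos_of_ne_one hγ hγ_ne h3

/-- A stationary point of the objective function is a parameter value whose Bregman divergence
(with respect to `A`) from `θ₀` is `log γ / n`. -/
theorem exists_hasDerivWithinAt_of_hasDerivWithinAt_g {n : ℕ} (hn : 0 < n) {θs : ℝ}
    (hne : θs ≠ θ₀) (hg : HasDerivWithinAt (g A γ n θ₀) 0 Θ θs) :
    ∃ d, HasDerivWithinAt A d Θ θs ∧ A θ₀ - A θs - d * (θ₀ - θs) = Real.log γ / n := by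
  have hn' : (n : ℝ) ≠ 0 := by positivity
  -- Solving for `A` transfers differentiability from `g` to `A`; as `g` has derivative zero, that
  -- of `A` is `g / n`.
  have hsub : ∀ θ ≠ θ₀, A θ = A θ₀ + (g A γ n θ₀ θ * (θ - θ₀) - Real.log γ) / n := by
    intro θ hθ
    rw [g, div_mul_cancel₀ _ (sub_ne_zero.2 hθ)]
    field_simp
    ring
  refine ⟨g A γ n θ₀ θs / n, ?_, ?_⟩
  · have h1 := (((hg.mul ((hasDerivWithinAt_id θs Θ).sub_const θ₀)).sub_const
      (Real.log γ)).div_const (n : ℝ)).const_add (A θ₀)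
    simp only [zero_mul, mul_one, zero_add] at h1
    refine h1.congr_of_eventuallyEq ?_ (hsub θs hne)
    filter_upwards [nhdsWithin_le_nhds (isOpen_ne.mem_nhds hne)] with θ hθ using hsub θ hθ
  · rw [hsub θs hne]
    field_simp
    ring

/-- The difference of the two sides is `A c - A θs - d (c - θs)` plus `(A'(c) - d) (θ₀ - c)`. The
first is nonnegative by convexity, the second because the derivative is monotone and `c` lies
between `θ₀` and `θs`. -/
theorem IsExpFamily.bregman_mono (hfam : IsExpFamily ν h T A Θ) (h0 : θ₀ ∈ Θ) {θs c d : ℝ}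
    (hs : θs ∈ Θ) (hd : HasDerivWithinAt A d Θ θs) (hc : c ∈ Set.Ioo (min θ₀ θs) (max θ₀ θs)) :
    A θ₀ - A c - deriv A c * (θ₀ - c) ≤ A θ₀ - A θs - d * (θ₀ - θs) := by
  have hcn := hfam.interval.mem_nhds_of_mem_Ioo h0 hs hc
  have hdc := (hfam.analyticAt hcn).differentiableAt.hasDerivAt
  have hcΘ := mem_of_mem_nhds hcn
  have hne : θs ≠ c := by
    rintro rfl
    rcases le_total θ₀ θs with h | h <;> simp [h] at hc
  have hn := fun t ht => hfam.interval.mem_nhds_of_mem_Ioo (t := t) hs hcΘ ht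
  obtain ⟨t, ht, h1⟩ := hfam.exists_taylor_two hne hs hcΘ hd hdc.continuousAt.continuousWithinAt
  obtain ⟨u, hu, h2⟩ := hfam.exists_taylor_two hne.symm hcΘ hs hdc.hasDerivWithinAt
    hd.continuousWithinAt
  have h1' : 0 ≤ A c - A θs - d * (c - θs) := by
    rw [h1]
    exact mul_nonneg (by positivity) (hfam.iteratedDeriv_two_nonneg (hn t ht))
  have h2' : 0 ≤ A θs - A c - deriv A c * (θs - c) := by
    rw [h2]
    rw [min_comm, max_comm] at hu
    exact mul_nonneg (by positivity) (hfam.iteratedDeriv_two_nonneg (hn u hu))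
  have hmono : 0 ≤ (d - deriv A c) * (θs - c) := by nlinarith
  have hkey : 0 ≤ (deriv A c - d) * (θ₀ - c) := by
    rcases le_total θ₀ θs with h | h
    · rw [min_eq_left h, max_eq_right h] at hc
      have : 0 ≤ d - deriv A c := nonneg_of_mul_nonneg_left hmono (sub_pos.2 hc.2)
      nlinarith [hc.1]
    · rw [min_eq_right h, max_eq_left h] at hc
      have : 0 ≤ deriv A c - d :=
        nonneg_of_mul_nonneg_left (b := c - θs) (by linarith) (sub_pos.2 hc.1)
      nlinarith [hc.2]
  linarith

theorem IsExpFamily.continuousAt_iteratedDeriv_two (hfam : IsExpFamily ν h T A Θ)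
    (hΘ : Θ ∈ 𝓝 θ₀) : ContinuousAt (iteratedDeriv 2 A) θ₀ := by
  rw [iteratedDeriv_succ, iteratedDeriv_one]
  exact (hfam.analyticAt hΘ).deriv.deriv.continuousAt

/-- Points whose Bregman divergence from `θ₀` tends to zero converge to `θ₀`. -/
theorem IsExpFamily.tendsto_of_bregman (hfam : IsExpFamily ν h T A Θ) (hΘ : Θ ∈ 𝓝 θ₀)
    (hpos : 0 < iteratedDeriv 2 A θ₀) {θs d ε : ℕ → ℝ} (hmem : ∀ᶠ n in atTop, θs n ∈ Θ)
    (hd : ∀ᶠ n in atTop, HasDerivWithinAt A (d n) Θ (θs n))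
    (hε : ∀ᶠ n in atTop, A θ₀ - A (θs n) - d n * (θ₀ - θs n) = ε n)
    (hε0 : Tendsto ε atTop (𝓝 0)) : Tendsto θs atTop (𝓝 θ₀) := by
  have h0 := mem_of_mem_nhds hΘ
  obtain ⟨r, hr, hball⟩ := Metric.eventually_nhds_iff_ball.1
    (((hfam.continuousAt_iteratedDeriv_two hΘ).eventually_const_lt hpos).and
      (eventually_mem_nhds_iff.2 hΘ))
  have hB : ∀ c ∈ Metric.ball θ₀ r, c ≠ θ₀ → 0 < A θ₀ - A c - deriv A c * (θ₀ - c) := by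
    intro c hc hne
    have hcn := (hball c hc).2
    obtain ⟨t, ht, h1⟩ := hfam.exists_taylor_two hne (mem_of_mem_nhds hcn) h0
      (hfam.analyticAt hcn).differentiableAt.hasDerivAt.hasDerivWithinAt
      (hfam.analyticAt hΘ).continuousAt.continuousWithinAt
    rw [h1]
    have ht' : t ∈ Metric.ball θ₀ r := by
      have : Set.uIcc c θ₀ ⊆ Metric.ball θ₀ r := by
        rw [← segment_eq_uIcc]
        exact (convex_ball θ₀ r).segment_subset hc (Metric.mem_ball_self hr)
      exact this ⟨ht.1.le, ht.2.le⟩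
    have := sub_ne_zero.2 hne.symm
    exact mul_pos (by positivity) (hball t ht').1
  rw [Metric.tendsto_nhds]
  intro e he
  -- Beyond `θ₀ ± η` the divergence is at least its value at `θ₀ + η` or `θ₀ - η`, both positive
  -- because `A'' > 0` on the ball of radius `r`.
  set η := min e r / 2 with hη
  have hη0 : 0 < η := by positivity
  have hηe : η < e := by linarith [min_le_left e r, lt_min he hr]
  have hηr : η < r := by linarith [min_le_right e r, lt_min he hr]
  have hp := hB (θ₀ + η) (by simpa [abs_of_pos hη0] using hηr) (by linarith)
  have hm := hB (θ₀ - η) (by simpa [Real.dist_eq, abs_of_pos hη0] using hηr) (by linarith)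
  filter_upwards [hmem, hd, hε, hε0.eventually_lt_const hp, hε0.eventually_lt_const hm]
    with n h1 h2 h3 h4 h5
  rw [Real.dist_eq, abs_lt]
  by_contra! hcon
  rcases lt_or_ge (-e) (θs n - θ₀) with h | h
  · have hgt : θ₀ + η < θs n := by linarith [hcon h]
    have := hfam.bregman_mono h0 h1 h2 (c := θ₀ + η) (by
      rw [min_eq_left (by linarith), max_eq_right (by linarith)]
      constructor <;> linarith)
    linarith
  · have hlt : θs n < θ₀ - η := by linarith
    have := hfam.bregman_mono h0 h1 h2 (c := θ₀ - η) (by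
      rw [min_eq_right (by linarith), max_eq_left (by linarith)]
      constructor <;> linarith)
    linarith

/-- Intermediate points of a second-order expansion at `θ₀` may be replaced by `θ₀` in the limit. -/
theorem IsExpFamily.tendsto_iteratedDeriv_two_of_between (hfam : IsExpFamily ν h T A Θ) (hΘ : Θ ∈ 𝓝 θ₀)
    {θs t : ℕ → ℝ} (hθs : Tendsto θs atTop (𝓝 θ₀))
    (ht : ∀ᶠ n in atTop, t n ∈ Set.Ioo (min θ₀ (θs n)) (max θ₀ (θs n))) :
    Tendsto (fun n => iteratedDeriv 2 A (t n)) atTop (𝓝 (iteratedDeriv 2 A θ₀)) := by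
  refine (hfam.continuousAt_iteratedDeriv_two hΘ).tendsto.comp ?_
  have hmin := (tendsto_const_nhds (x := θ₀)).min hθs
  have hmax := (tendsto_const_nhds (x := θ₀)).max hθs
  rw [min_self] at hmin
  rw [max_self] at hmax
  exact tendsto_of_tendsto_of_tendsto_of_le_of_le' hmin hmax (ht.mono fun n hn => hn.1.le)
    (ht.mono fun n hn => hn.2.le)

/-! ### Exact distance and rate of approach of stationary alternatives -/

/-- At a stationary point of the objective function, `log γ` is `n (θs - θ₀)² A''(t) / 2` for
some `t` strictly between `θ₀` and `θs`. -/
theorem IsStationaryUMPBT.exists_log_eq (hfam : IsExpFamily ν h T A Θ) (hΘ₁ : Θ₁ ⊆ Θ)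
    (hΘ : Θ ∈ 𝓝 θ₀) (hγ : 0 < γ) (hγ_ne : γ ≠ 1) {n : ℕ} (hn : 0 < n) {θs : ℝ}
    (hs : IsStationaryUMPBT ν h T A Θ Θ₁ θ₀ γ n θs) :
    ∃ t ∈ Set.Ioo (min θ₀ θs) (max θ₀ θs),
      n * (θs - θ₀) ^ 2 * iteratedDeriv 2 A t = 2 * Real.log γ := by
  have hc := (hfam.analyticAt hΘ).continuousAt
  have hne := ne_of_hasDerivWithinAt_g hΘ hc hγ hγ_ne hs.2
  obtain ⟨d, hd, heq⟩ := exists_hasDerivWithinAt_of_hasDerivWithinAt_g hn hne hs.2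
  obtain ⟨t, ht, h1⟩ := hfam.exists_taylor_two hne (hΘ₁ hs.mem) (mem_of_mem_nhds hΘ) hd
    hc.continuousWithinAt
  rw [min_comm, max_comm] at ht
  refine ⟨t, ht, ?_⟩
  rw [heq, div_eq_iff (by positivity)] at h1
  rw [h1]
  ring

/-- If `A''(θ₀)` vanished, `A` would be affine on `Θ`, so `A''(t) = 0` and `log γ = 0`. -/
theorem IsStationaryUMPBT.iteratedDeriv_two_pos (hfam : IsExpFamily ν h T A Θ) (hΘ₁ : Θ₁ ⊆ Θ)
    (hΘ : Θ ∈ 𝓝 θ₀) (hγ : 0 < γ) (hγ_ne : γ ≠ 1) {n : ℕ} (hn : 0 < n) {θs : ℝ}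
    (hs : IsStationaryUMPBT ν h T A Θ Θ₁ θ₀ γ n θs) : 0 < iteratedDeriv 2 A θ₀ := by
  refine (hfam.iteratedDeriv_two_nonneg hΘ).lt_of_ne' fun h0 => ?_
  obtain ⟨t, ht, heq⟩ := hs.exists_log_eq hfam hΘ₁ hΘ hγ hγ_ne hn
  have htn := hfam.interval.mem_nhds_of_mem_Ioo (mem_of_mem_nhds hΘ) (hΘ₁ hs.mem) ht
  have haff : A =ᶠ[𝓝 t] fun s => A θ₀ + deriv A θ₀ * (s - θ₀) := by
    filter_upwards [htn] with s hs using hfam.eq_affine_of_iteratedDeriv_two_eq_zero hΘ h0 hs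
  have : iteratedDeriv 2 A t = 0 := by
    rw [iteratedDeriv_succ, iteratedDeriv_one, haff.deriv.deriv_eq]
    simp
  rw [this, mul_zero] at heq
  exact Real.log_ne_zero_of_pos_of_ne_one hγ hγ_ne (by linarith)

theorem abs_sub_eq_sqrt_of_isStationaryUMPBT (hfam : IsExpFamily ν h T A Θ) (hΘ₁ : Θ₁ ⊆ Θ)
    (hΘ : Θ ∈ 𝓝 θ₀) (hγ : 0 < γ) (hγ_ne : γ ≠ 1) {n : ℕ} (hn : 0 < n) {θs : ℝ}
    (hs : IsStationaryUMPBT ν h T A Θ Θ₁ θ₀ γ n θs) :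
    ∃ t ∈ Set.Ioo (min θ₀ θs) (max θ₀ θs),
      |θs - θ₀| = Real.sqrt (2 * Real.log γ / (n * iteratedDeriv 2 A t)) := by
  obtain ⟨t, ht, heq⟩ := hs.exists_log_eq hfam hΘ₁ hΘ hγ hγ_ne hn
  refine ⟨t, ht, ?_⟩
  have hne : iteratedDeriv 2 A t ≠ 0 := by
    intro h0
    rw [h0, mul_zero] at heq
    exact Real.log_ne_zero_of_pos_of_ne_one hγ hγ_ne (by linarith)
  rw [← heq, ← Real.sqrt_sq_eq_abs]
  congr 1
  field_simp

/-- Stationary UMPBT alternatives approach the null value, at the exact rate `n^(-1/2)`. -/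
theorem tendsto_of_isStationaryUMPBT (hfam : IsExpFamily ν h T A Θ) (hΘ₁ : Θ₁ ⊆ Θ)
    (hΘ : Θ ∈ 𝓝 θ₀) (hγ : 0 < γ) (hγ_ne : γ ≠ 1) {θs : ℕ → ℝ}
    (hs : ∀ᶠ n in atTop, IsStationaryUMPBT ν h T A Θ Θ₁ θ₀ γ n (θs n)) :
    0 < iteratedDeriv 2 A θ₀ ∧ Tendsto θs atTop (𝓝 θ₀) ∧
      Tendsto (fun n : ℕ => n * (θs n - θ₀) ^ 2) atTop
        (𝓝 (2 * Real.log γ / iteratedDeriv 2 A θ₀)) := by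
  have hc := (hfam.analyticAt hΘ).continuousAt
  have hs' := hs.and (eventually_gt_atTop 0)
  have hpos : 0 < iteratedDeriv 2 A θ₀ := by
    obtain ⟨n, h1, hn⟩ := hs'.exists
    exact h1.iteratedDeriv_two_pos hfam hΘ₁ hΘ hγ hγ_ne hn
  have hd : ∀ᶠ n in atTop, ∃ d, HasDerivWithinAt A d Θ (θs n) ∧
      A θ₀ - A (θs n) - d * (θ₀ - θs n) = Real.log γ / n := by
    filter_upwards [hs'] with n hn
    exact exists_hasDerivWithinAt_of_hasDerivWithinAt_g hn.2
      (ne_of_hasDerivWithinAt_g hΘ hc hγ hγ_ne hn.1.2) hn.1.2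
  obtain ⟨d, hd⟩ := hd.choice
  have hlim : Tendsto θs atTop (𝓝 θ₀) :=
    hfam.tendsto_of_bregman hΘ hpos (hs.mono fun n hn => hΘ₁ hn.mem) (hd.mono fun n hn => hn.1)
      (hd.mono fun n hn => hn.2) (tendsto_const_div_atTop_nhds_zero_nat _)
  refine ⟨hpos, hlim, ?_⟩
  obtain ⟨t, ht⟩ := (hs'.mono fun n hn =>
    hn.1.exists_log_eq hfam hΘ₁ hΘ hγ hγ_ne hn.2).choice
  have hA := hfam.tendsto_iteratedDeriv_two_of_between hΘ hlim (ht.mono fun n hn => hn.1)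
  refine ((tendsto_const_nhds (x := 2 * Real.log γ)).div hA hpos.ne').congr' ?_
  filter_upwards [ht, hA.eventually_ne hpos.ne'] with n hn hne
  exact (eq_div_of_mul_eq hne hn.2).symm

/-! ### Limit law of the weight of evidence -/

theorem IsExpFamily.tendsto_mul_remainder (hfam : IsExpFamily ν h T A Θ) (hΘ : Θ ∈ 𝓝 θ₀)
    {θs : ℕ → ℝ} {τ : ℝ} (hmem : ∀ᶠ n in atTop, θs n ∈ Θ)
    (hcont : ∀ᶠ n in atTop, θs n ≠ θ₀ ∧ ContinuousWithinAt A Θ (θs n))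
    (hlim : Tendsto θs atTop (𝓝 θ₀))
    (hτ : Tendsto (fun n : ℕ => n * (θs n - θ₀) ^ 2) atTop (𝓝 τ)) :
    Tendsto (fun n : ℕ => n * (A (θs n) - A θ₀ - deriv A θ₀ * (θs n - θ₀))) atTop
      (𝓝 (τ * iteratedDeriv 2 A θ₀ / 2)) := by
  obtain ⟨t, ht⟩ := ((hmem.and hcont).mono fun n hn =>
    hfam.exists_taylor_two hn.2.1.symm (mem_of_mem_nhds hΘ) hn.1
      (hfam.analyticAt hΘ).differentiableAt.hasDerivAt.hasDerivWithinAt hn.2.2).choice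
  have hA := hfam.tendsto_iteratedDeriv_two_of_between hΘ hlim (ht.mono fun n hn => hn.1)
  refine ((hτ.mul hA).div_const 2).congr' ?_
  filter_upwards [ht] with n hn
  rw [hn.2]
  ring

theorem tendstoInDistribution_weightOfEvidence (hfam : IsExpFamily ν h T A Θ) (hΘ₁ : Θ₁ ⊆ Θ)
    (hΘ : Θ ∈ 𝓝 θ₀) (hγ : 0 < γ) (hγ_ne : γ ≠ 1) {θs : ℕ → ℝ}
    (hs : ∀ᶠ n in atTop, IsStationaryUMPBT ν h T A Θ Θ₁ θ₀ γ n (θs n))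
    {Ω : Type*} [MeasurableSpace Ω] {P : Measure Ω} [IsProbabilityMeasure P] {X : ℕ → Ω → 𝓧}
    (hX : ∀ i, HasLaw (X i) (law ν h T A θ₀) P) (hindep : iIndepFun X P) :
    TendstoInDistribution
      (fun (n : ℕ) ω => weightOfEvidence h T A θ₀ (θs n) fun i : Fin n => X i ω)
      atTop id (fun _ => P) (gaussianReal (-Real.log γ) (Real.toNNReal (2 * Real.log γ))) := by
  have hT := hfam.measurable_T
  have h0 := mem_of_mem_nhds hΘ
  have := hfam.isProbabilityMeasure_law h0
  obtain ⟨hpos, hlim, hτ⟩ := tendsto_of_isStationaryUMPBT hfam hΘ₁ hΘ hγ hγ_ne hs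
  have hcont : ∀ᶠ n in atTop, θs n ≠ θ₀ ∧ ContinuousWithinAt A Θ (θs n) := by
    filter_upwards [hs, eventually_gt_atTop 0] with n hn hn0
    have hne := ne_of_hasDerivWithinAt_g hΘ (hfam.analyticAt hΘ).continuousAt hγ hγ_ne hn.2
    obtain ⟨d, hd, -⟩ := exists_hasDerivWithinAt_of_hasDerivWithinAt_g hn0 hne hn.2
    exact ⟨hne, hd.continuousWithinAt⟩
  have hrem := hfam.tendsto_mul_remainder hΘ (hs.mono fun n hn => hΘ₁ hn.mem) hcont hlim hτ
  rw [div_mul_cancel₀ _ hpos.ne', mul_div_cancel_left₀ _ two_ne_zero] at hrem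
  set m := deriv A θ₀ with hm
  set Y : ℕ → Ω → ℝ := fun i ω => T (X i ω) - m with hYdef
  have hTm : Measurable fun x => T x - m := hT.sub_const m
  have hYlaw : ∀ i, HasLaw (Y i) ((law ν h T A θ₀).map fun x => T x - m) P := fun i =>
    HasLaw.fun_comp ⟨hTm.aemeasurable, rfl⟩ (hX i)
  have hident : ∀ i, IdentDistrib (Y i) (Y 0) P P := fun i =>
    ⟨(hYlaw i).aemeasurable, (hYlaw 0).aemeasurable, by rw [(hYlaw i).map_eq, (hYlaw 0).map_eq]⟩
  have hTX : IdentDistrib (fun ω => T (X 0 ω)) T P (law ν h T A θ₀) :=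
    ⟨hT.comp_aemeasurable (hX 0).aemeasurable, hT.aemeasurable, by
      rw [← (hX 0).map_eq, AEMeasurable.map_map_of_aemeasurable hT.aemeasurable (hX 0).aemeasurable]
      rfl⟩
  have hmem : MemLp (fun ω => T (X 0 ω)) 2 P := hTX.memLp_iff.2 (hfam.memLp_two hΘ)
  have hmean : P[Y 0] = 0 := by
    have : P[fun ω => T (X 0 ω)] = m := by rw [hTX.integral_eq, hm, hfam.deriv_eq_integral hΘ]
    simp only [hYdef]
    rw [integral_sub (hmem.integrable one_le_two) (integrable_const _), this]
    simp
  have hvar : Var[Y 0; P] = iteratedDeriv 2 A θ₀ := by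
    rw [hfam.iteratedDeriv_two_eq_variance hΘ, ← hTX.variance_eq]
    exact variance_sub_const hmem.1 m
  -- The norming is `a n = θs n - θ₀`, the centering `b n` is minus `n` times the Taylor remainder,
  -- and `τ = 2 log γ / A''(θ₀)`.
  have hclt := tendstoInDistribution_mul_sum_add (hindep.comp (fun _ x => T x - m) fun _ => hTm)
    hident (hmem.sub (memLp_const m)) hmean hτ hrem.neg
  have hv : 2 * Real.log γ / iteratedDeriv 2 A θ₀ * Var[Y 0; P] = 2 * Real.log γ := by
    rw [hvar, div_mul_cancel₀ _ hpos.ne']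
  change TendstoInDistribution _ _ _ _ (gaussianReal _ (_ * Var[Y 0; P]).toNNReal) at hclt
  simp only [hv] at hclt
  refine hclt.congr (fun n => ?_) (EventuallyEq.refl _ _)
  -- Almost surely no observation falls where `h` vanishes, so the logarithm of the Bayes factor
  -- splits.
  have hpX : ∀ᵐ ω ∂P, ∀ i, 0 < h (X i ω) := ae_all_iff.2 fun i =>
    ((hX i).ae_iff (measurableSet_setOfPred.1
      (measurableSet_lt measurable_const hfam.measurable_h))).2 (hfam.ae_law_pos θ₀)
  filter_upwards [hpX] with ω hω
  rw [weightOfEvidence_eq T A θ₀ (θs n) fun i : Fin n => hω i,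
    Fin.sum_univ_eq_sum_range (fun i => T (X i ω)) n]
  simp only [Function.comp, Finset.sum_sub_distrib, Finset.sum_const, Finset.card_range,
    nsmul_eq_mul]
  ring

end UMPBT

theorem lemma2 {𝓧 : Type*} [MeasurableSpace 𝓧] (ν : Measure 𝓧) (h T : 𝓧 → ℝ) (A : ℝ → ℝ)
    (Θ Θ₁ : Set ℝ) (hfam : UMPBT.IsExpFamily ν h T A Θ) (hΘ₁ : Θ₁ ⊆ Θ)
    (θ₀ : ℝ) (hΘ : Θ ∈ 𝓝 θ₀) (hA : UMPBT.HasThreeBoundedDerivs A θ₀)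
    (γ : ℝ) (hγ : 0 < γ) (hγ_ne : γ ≠ 1) :
    (∀ n : ℕ, 0 < n → ∀ θs : ℝ, UMPBT.IsStationaryUMPBT ν h T A Θ Θ₁ θ₀ γ n θs →
      ∃ t ∈ Set.Ioo (min θ₀ θs) (max θ₀ θs),
        |θs - θ₀| = Real.sqrt (2 * Real.log γ / (n * iteratedDeriv 2 A t))) ∧
    (∀ θs : ℕ → ℝ,
      (∀ᶠ n in atTop, UMPBT.IsStationaryUMPBT ν h T A Θ Θ₁ θ₀ γ n (θs n)) →
      ∀ (Ω : Type*) [MeasurableSpace Ω] (P : Measure Ω) [IsProbabilityMeasure P]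
        (X : ℕ → Ω → 𝓧), (∀ i, HasLaw (X i) (UMPBT.law ν h T A θ₀) P) → iIndepFun X P →
        TendstoInDistribution
          (fun (n : ℕ) ω => UMPBT.weightOfEvidence h T A θ₀ (θs n) fun i : Fin n => X i ω)
          atTop id (fun _ => P)
          (gaussianReal (-Real.log γ) (Real.toNNReal (2 * Real.log γ)))) := by
  exact ⟨fun n hn θs hs =>
      UMPBT.abs_sub_eq_sqrt_of_isStationaryUMPBT hfam hΘ₁ hΘ hγ hγ_ne hn hs,
    fun θs hs Ω _ P _ X hX hindep =>
      UMPBT.tendstoInDistribution_weightOfEvidence hfam hΘ₁ hΘ hγ hγ_ne hs hX hindep⟩
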